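/- Let $p$ be a prime and let $G_0$ be a finite group whose order is divisible by $p$. Let $\phi:{}_p\tilde G_0\to G_0$ be the universal $p$-Frattini cover of $G_0$: a continuous epimorphism from a profinite group, with pro-$p$ kernel, such that no proper closed subgroup of ${}_p\tilde G_0$ maps onto $G_0$, and such that $\phi$ factors continuously through every epimorphism $E\to G_0$ from a finite group $E$ with $p$-group kernel (these properties determine $\phi$ up to isomorphism over $G_0$). Put $\ker_0=\ker(\phi)$, let $\ker_1$ be the Frattini subgroup of $\ker_0$ (the intersection of its maximal open subgroups), let $G_1={}_p\tilde G_0/\ker_1$, and let $\phi_{1,0}:G_1\to G_0$ be the map induced by $\phi$. Let $P_0$ be a $p$-Sylow subgroup of $G_0$ and let $G_0'=N_{G_0}(P_0)$ be its normalizer in $G_0$. Then the extension $\phi_{1,0}^{-1}(G_0')\to G_0'$ does not split: there is no homomorphism $s:G_0'\to\phi_{1,0}^{-1}(G_0')$ with $\phi_{1,0}\circ s=\mathrm{id}_{G_0'}$. -/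

import Mathlib

universe u

/-- A profinite group is pro-`p` if every quotient by an open normal subgroup is a `p`-group. -/
def IsProP (p : ℕ) (K : Type u) [Group K] [TopologicalSpace K] : Prop :=
  ∀ U : Subgroup K, U.Normal → IsOpen (U : Set K) → ∀ x : K, ∃ n : ℕ, x ^ p ^ n ∈ U

/-- The Frattini subgroup of a profinite group: the intersection of its maximal open subgroups. -/
def profiniteFrattini (K : Type u) [Group K] [TopologicalSpace K] : Subgroup K :=
  sInf {M : Subgroup K | IsCoatom M ∧ IsOpen (M : Set K)}

/-- The Frattini subgroup of a subgroup `K` of `Γ` (with the subspace topology), viewed as a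
subgroup of `Γ`. -/
def frattiniIn {Γ : Type u} [Group Γ] [TopologicalSpace Γ] (K : Subgroup Γ) : Subgroup Γ :=
  (profiniteFrattini K).map K.subtype

theorem frattiniIn_le {Γ : Type u} [Group Γ] [TopologicalSpace Γ] (K : Subgroup Γ) :
    frattiniIn K ≤ K :=
  Subgroup.map_subtype_le _

theorem frattiniIn_normal {Γ : Type u} [Group Γ] [TopologicalSpace Γ] [IsTopologicalGroup Γ]
    (K : Subgroup Γ) (hK : K.Normal) : (frattiniIn K).Normal := by
  refine ⟨?_⟩
  rintro _ ⟨x, hx, rfl⟩ g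
  refine ⟨MulAut.conjNormal g x, ?_, by simp⟩
  simp only [SetLike.mem_coe, profiniteFrattini, Subgroup.mem_sInf, Set.mem_ofPred_eq] at hx ⊢
  rintro M ⟨hM, hMo⟩
  have h := hx (M.comap (MulAut.conjNormal g : MulAut K).toMonoidHom)
    ⟨(Subgroup.isCoatom_comap (MulAut.conjNormal g : MulAut K)).2 hM, ?_⟩
  · exact h
  · refine hMo.preimage (f := fun y : K => MulAut.conjNormal g y) ?_
    rw [continuous_induced_rng]
    have h : (Subtype.val ∘ fun y : K => MulAut.conjNormal g y) =
        fun y : K => g * (y : Γ) * g⁻¹ := by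
      ext y
      simp
    rw [h]
    fun_prop

/-- A `p`-Frattini cover of a finite (discrete) group `G`: a continuous epimorphism `φ : Γ → G`
from a profinite group, with pro-`p` kernel, such that no proper closed subgroup of `Γ` maps onto
`G`. Continuity of a homomorphism to a discrete group means that its kernel is open. -/
structure IsPFrattiniCover (p : ℕ) {Γ G : Type u} [Group Γ] [TopologicalSpace Γ] [Group G]
    (φ : Γ →* G) : Prop where
  continuous : IsOpen (φ.ker : Set Γ)
  surjective : Function.Surjective φ
  proP_ker : IsProP p φ.ker
  frattini : ∀ H : Subgroup Γ, IsClosed (H : Set Γ) → H.map φ = ⊤ → H = ⊤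

/-- A universal `p`-Frattini cover of a finite group `G`: a `p`-Frattini cover that is versal for
the covers of `G` with `p`-group kernel, that is, it factors continuously through each of them. -/
structure IsUniversalPFrattiniCover (p : ℕ) {Γ G : Type u} [Group Γ] [TopologicalSpace Γ]
    [Group G] (φ : Γ →* G) : Prop extends IsPFrattiniCover p φ where
  versal : ∀ (E : Type u) [Group E] [Finite E] (ψ : E →* G), Function.Surjective ψ →
    IsPGroup p ψ.ker → ∃ γ : Γ →* E, IsOpen (γ.ker : Set Γ) ∧ ψ.comp γ = φ

section Characteristic

variable {Γ G : Type u} [Group Γ] [TopologicalSpace Γ] [Group G]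

/-- `ker₀ = ker φ`, and `kerₖ₊₁` is the Frattini subgroup of `kerₖ`. -/
def charKer (φ : Γ →* G) : ℕ → Subgroup Γ
  | 0 => φ.ker
  | k + 1 => frattiniIn (charKer φ k)

theorem charKer_le_ker (φ : Γ →* G) : ∀ k, charKer φ k ≤ φ.ker
  | 0 => le_rfl
  | k + 1 => (frattiniIn_le _).trans (charKer_le_ker φ k)

instance charKer_normal [IsTopologicalGroup Γ] (φ : Γ →* G) : ∀ k, (charKer φ k).Normal
  | 0 => inferInstanceAs φ.ker.Normal
  | k + 1 => frattiniIn_normal _ (charKer_normal φ k)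

/-- The `k`-th characteristic quotient `Gₖ = Γ / kerₖ`. -/
abbrev CharQuot [IsTopologicalGroup Γ] (φ : Γ →* G) (k : ℕ) : Type u := Γ ⧸ charKer φ k

/-- The natural map `φₖ,₀ : Gₖ → G`, where `G` is identified with `G₀ = Γ / ker φ` through `φ`. -/
def charQuotMap [IsTopologicalGroup Γ] (φ : Γ →* G) (k : ℕ) : CharQuot φ k →* G :=
  QuotientGroup.lift (charKer φ k) φ (charKer_le_ker φ k)

end Characteristic

/-- The extension `f⁻¹(N) → N` obtained by restricting `f : E → G` to the preimage of `N ≤ G` is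
split: it has a homomorphic section. -/
def RestrictionSplits {E G : Type u} [Group E] [Group G] (f : E →* G) (N : Subgroup G) : Prop :=
  ∃ s : N →* N.comap f, (f.subgroupComap N).comp s = MonoidHom.id N

/-! A splitting over any subgroup containing an element `x` of order `p` would lift `x` to an
element of order `p` in `Γ ⧸ charKer φ 1`, and `pow_notMem_frattiniIn_ker` excludes this. By
versality it suffices to test against one extension of `G`: pull `ℤ/p² → ℤ/p` back to `C = ⟨x⟩` and
induce to `G`. Over `C`, the fibre coordinate at the trivial coset is a homomorphism to `ℤ/p²`
lifting an isomorphism `C ≃ ℤ/p`, so the `p`-th power of a lift of `x` has nonzero coordinate. On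
`φ.ker` this coordinate is a continuous character into `pℤ/p²ℤ`, hence it vanishes on the Frattini
subgroup. -/

namespace LiftedInducedExtension

/-- For `χ : C → ℤ/p` on a subgroup `C` of `G`, the extension of `χ` to `G` along the chosen
transversal of `G ⧸ C`: it satisfies `transversalExt χ (h * c) = transversalExt χ h + χ c`. -/
noncomputable def transversalExt {G : Type u} [Group G] {p : ℕ} {C : Subgroup G}
    (χ : C →* Multiplicative (ZMod p)) (h : G) : ZMod p :=
  (χ ⟨(h : G ⧸ C).out⁻¹ * h, QuotientGroup.eq.1 (QuotientGroup.out_eq' _)⟩).toAdd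

theorem transversalExt_mul {G : Type u} [Group G] {p : ℕ} {C : Subgroup G}
    (χ : C →* Multiplicative (ZMod p)) (h : G) (c : C) :
    transversalExt χ (h * c) = transversalExt χ h + (χ c).toAdd := by
  unfold transversalExt
  rw [← toAdd_mul, ← map_mul]
  congr 2
  ext
  have : ((h * c : G) : G ⧸ C) = (h : G ⧸ C) := by
    rw [QuotientGroup.eq]
    simp
  simp [this, mul_assoc]

end LiftedInducedExtension

open LiftedInducedExtension

/-- The extension of `G` whose kernel consists of the functions `G ⧸ C → pℤ/p²ℤ`, obtained by
inducing to `G` the extension of `C` that is the pullback along `χ` of `ℤ/p² → ℤ/p`. -/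
@[ext]
structure LiftedInducedExtension {G : Type u} [Group G] {p : ℕ} {C : Subgroup G}
    (χ : C →* Multiplicative (ZMod p)) : Type u where
  /-- The image in `G`. -/
  base : G
  /-- The function on cosets. -/
  fib : G ⧸ C → ZMod (p ^ 2)
  cast_fib : ∀ h : G, ZMod.castHom (dvd_pow_self p two_ne_zero) (ZMod p) (fib h) =
    transversalExt χ (base * h) - transversalExt χ h

namespace LiftedInducedExtension

variable {G : Type u} [Group G] {p : ℕ} {C : Subgroup G} {χ : C →* Multiplicative (ZMod p)}

instance : Mul (LiftedInducedExtension χ) where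
  mul a b :=
    { base := a.base * b.base
      fib := fun q => a.fib (b.base • q) + b.fib q
      cast_fib := fun h => by
        have := a.cast_fib (b.base * h)
        rw [map_add, b.cast_fib, MulAction.Quotient.smul_coe, smul_eq_mul, this, mul_assoc]
        ring }

instance : One (LiftedInducedExtension χ) where
  one := { base := 1, fib := 0, cast_fib := fun h => by simp }

instance : Inv (LiftedInducedExtension χ) where
  inv a :=
    { base := a.base⁻¹
      fib := fun q => -a.fib (a.base⁻¹ • q)
      cast_fib := fun h => by
        have := a.cast_fib (a.base⁻¹ * h)
        rw [mul_inv_cancel_left] at this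
        rw [map_neg, MulAction.Quotient.smul_coe, smul_eq_mul, this, neg_sub] }

@[simp] theorem base_mul (a b : LiftedInducedExtension χ) : (a * b).base = a.base * b.base := rfl
@[simp] theorem base_one : (1 : LiftedInducedExtension χ).base = 1 := rfl
@[simp] theorem base_inv (a : LiftedInducedExtension χ) : a⁻¹.base = a.base⁻¹ := rfl
@[simp] theorem fib_mul (a b : LiftedInducedExtension χ) (q : G ⧸ C) :
    (a * b).fib q = a.fib (b.base • q) + b.fib q := rfl
@[simp] theorem fib_one (q : G ⧸ C) : (1 : LiftedInducedExtension χ).fib q = 0 := rfl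
@[simp] theorem fib_inv (a : LiftedInducedExtension χ) (q : G ⧸ C) :
    a⁻¹.fib q = -a.fib (a.base⁻¹ • q) := rfl

instance : Group (LiftedInducedExtension χ) :=
  Group.ofLeftAxioms
    (fun a b c => by ext <;> simp [mul_assoc, mul_smul, add_assoc])
    (fun a => by ext <;> simp)
    (fun a => by ext <;> simp)

instance [Finite G] [NeZero p] : Finite (LiftedInducedExtension χ) :=
  Finite.of_injective (fun a => (a.base, a.fib)) fun a b h => by
    simp only [Prod.mk.injEq] at h
    exact LiftedInducedExtension.ext h.1 h.2

/-- The projection to `G`. -/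
@[simps] def proj (χ : C →* Multiplicative (ZMod p)) : LiftedInducedExtension χ →* G where
  toFun := base
  map_one' := rfl
  map_mul' _ _ := rfl

/-- Replacing `h` by `h * c` adds `χ c` to both terms of the prescribed residue, so it depends only
on the coset and can be lifted to `ℤ/p²` coset by coset. -/
theorem proj_surjective (χ : C →* Multiplicative (ZMod p)) : Function.Surjective (proj χ) := by
  intro g
  have hinv : ∀ q : G ⧸ C, ∃ v : ZMod (p ^ 2), ∀ h : G, (h : G ⧸ C) = q →
      ZMod.castHom (dvd_pow_self p two_ne_zero) (ZMod p) v =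
        transversalExt χ (g * h) - transversalExt χ h := by
    intro q
    induction q using QuotientGroup.induction_on with | H k
    obtain ⟨v, hv⟩ := ZMod.castHom_surjective (dvd_pow_self p two_ne_zero)
      (transversalExt χ (g * k) - transversalExt χ k)
    refine ⟨v, fun h hh => ?_⟩
    have hc : k⁻¹ * h ∈ C := QuotientGroup.eq.1 hh.symm
    have h₁ := transversalExt_mul χ k ⟨_, hc⟩
    have h₂ := transversalExt_mul χ (g * k) ⟨_, hc⟩
    simp only [mul_inv_cancel_left, mul_assoc] at h₁ h₂
    rw [hv, h₁, h₂]
    ring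
  choose f hf using hinv
  exact ⟨⟨g, f, fun h => hf _ h rfl⟩, rfl⟩

theorem isPGroup_ker_proj (χ : C →* Multiplicative (ZMod p)) : IsPGroup p (proj χ).ker := by
  rintro ⟨a, ha⟩
  have ha' : a.base = 1 := ha
  have hpow : ∀ n : ℕ, (a ^ n).base = 1 ∧ ∀ q, (a ^ n).fib q = n * a.fib q := by
    intro n
    induction n with
    | zero => simp
    | succ n ih => simp [pow_succ, ih.1, ih.2, ha', add_mul]
  refine ⟨2, Subtype.ext (LiftedInducedExtension.ext (hpow _).1 (funext fun q => ?_))⟩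
  simp [(hpow _).2]

end LiftedInducedExtension

theorem ZMod.exists_eq_mul_of_castHom_eq_zero {p : ℕ} [NeZero p] {v : ZMod (p ^ 2)}
    (hv : ZMod.castHom (dvd_pow_self p two_ne_zero) (ZMod p) v = 0) :
    ∃ m : ℕ, v = p * m := by
  obtain ⟨n, rfl⟩ := ZMod.natCast_zmod_surjective v
  rw [map_natCast, ZMod.natCast_eq_zero_iff] at hv
  obtain ⟨m, rfl⟩ := hv
  exact ⟨m, by push_cast; rfl⟩

theorem ZMod.castHom_eq_zero_of_natCast_mul_eq_zero {p : ℕ} [NeZero p] {v : ZMod (p ^ 2)}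
    (hv : (p : ZMod (p ^ 2)) * v = 0) :
    ZMod.castHom (dvd_pow_self p two_ne_zero) (ZMod p) v = 0 := by
  obtain ⟨n, rfl⟩ := ZMod.natCast_zmod_surjective v
  rw [map_natCast, ZMod.natCast_eq_zero_iff]
  rw [← Nat.cast_mul, ZMod.natCast_eq_zero_iff, sq] at hv
  exact Nat.dvd_of_mul_dvd_mul_left (Nat.pos_of_neZero p) hv

/-- The Frattini subgroup of `K` is killed by each continuous character to the subgroup of order
`p` in `ℤ/p²`. -/
theorem profiniteFrattini_le_ker {p : ℕ} (hp : p.Prime) {K : Type u} [Group K]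
    [TopologicalSpace K] (τ : K →* Multiplicative (ZMod (p ^ 2))) (hτ : IsOpen (τ.ker : Set K))
    (hpτ : ∀ k, ZMod.castHom (dvd_pow_self p two_ne_zero) (ZMod p) (τ k).toAdd = 0) :
    profiniteFrattini K ≤ τ.ker := by
  have := NeZero.mk hp.ne_zero
  have := Fact.mk hp
  by_cases htop : τ.ker = ⊤
  · rw [htop]
    exact le_top
  -- The image of `τ` has prime order, so any `w` outside the kernel generates it modulo `τ.ker`.
  refine sInf_le ⟨⟨htop, fun H hH => ?_⟩, hτ⟩
  obtain ⟨w, hw, hwτ⟩ := SetLike.exists_of_lt hH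
  refine eq_top_iff.2 fun k _ => ?_
  obtain ⟨m, hm⟩ := ZMod.exists_eq_mul_of_castHom_eq_zero (hpτ k)
  obtain ⟨l, hl⟩ := ZMod.exists_eq_mul_of_castHom_eq_zero (hpτ w)
  have hl0 : (l : ZMod p) ≠ 0 := by
    intro h0
    obtain ⟨j, rfl⟩ := (ZMod.natCast_eq_zero_iff _ _).1 h0
    refine hwτ (Multiplicative.toAdd.injective (hl.trans ?_))
    rw [toAdd_one, ← Nat.cast_mul, ZMod.natCast_eq_zero_iff]
    exact ⟨j, by ring⟩
  obtain ⟨n, hn⟩ := ZMod.natCast_zmod_surjective ((m : ZMod p) / (l : ZMod p))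
  have hml : m ≡ n * l [MOD p] := by
    rw [← ZMod.natCast_eq_natCast_iff, Nat.cast_mul, hn, div_mul_cancel₀ _ hl0]
  have hkw : τ k = τ (w ^ n) := by
    apply Multiplicative.toAdd.injective
    rw [map_pow, toAdd_pow, hm, hl, nsmul_eq_mul]
    have := hml.mul_left' p
    rw [← sq, ← ZMod.natCast_eq_natCast_iff] at this
    push_cast at this
    rw [this]
    ring
  have hmem : k * (w ^ n)⁻¹ ∈ τ.ker := by
    rw [MonoidHom.mem_ker, map_mul, map_inv, hkw, mul_inv_cancel]
  simpa using H.mul_mem (hH.le hmem) (H.pow_mem hw n)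

/-- In `Γ / Φ(ker φ)`, for `φ` a universal `p`-Frattini cover, an element over an element of
order `p` does not have order `p`. -/
theorem IsUniversalPFrattiniCover.pow_notMem_frattiniIn_ker {p : ℕ} (hp : p.Prime) {G Γ : Type u}
    [Group G] [Finite G] [Group Γ] [TopologicalSpace Γ] [IsTopologicalGroup Γ] {φ : Γ →* G}
    (hφ : IsUniversalPFrattiniCover p φ) {y : Γ} (hy : orderOf (φ y) = p) :
    y ^ p ∉ frattiniIn φ.ker := by
  have := NeZero.mk hp.ne_zero
  set C := Subgroup.zpowers (φ y)
  have hcard : Nat.card C = p := by rw [Nat.card_zpowers, hy]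
  obtain ⟨e⟩ : Nonempty (C ≃* Multiplicative (ZMod p)) := by
    subst hcard
    exact ⟨(zmodCyclicMulEquiv (inferInstance : IsCyclic C)).symm⟩
  have hyC : φ y ∈ C := Subgroup.mem_zpowers _
  obtain ⟨γ, hγ, hγφ⟩ := hφ.versal (LiftedInducedExtension e.toMonoidHom)
    (proj e.toMonoidHom) (proj_surjective _) (isPGroup_ker_proj _)
  have hbase : ∀ z, (γ z).base = φ z := fun z => DFunLike.congr_fun hγφ z
  have hone : (γ 1).fib ((1 : G) : G ⧸ C) = 0 := by
    rw [map_one, fib_one]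
  -- `C` is the stabilizer of the trivial coset, so the twist in `fib_mul` disappears there.
  have hmul : ∀ z w, φ w ∈ C → (γ (z * w)).fib ((1 : G) : G ⧸ C) =
      (γ z).fib ((1 : G) : G ⧸ C) + (γ w).fib ((1 : G) : G ⧸ C) := by
    intro z w hw
    have : φ w • ((1 : G) : G ⧸ C) = ((1 : G) : G ⧸ C) := by
      rw [MulAction.Quotient.smul_coe, QuotientGroup.eq]
      simpa using hw
    rw [map_mul, fib_mul, hbase, this]
  let τ : φ.ker →* Multiplicative (ZMod (p ^ 2)) :=
    { toFun := fun k => .ofAdd ((γ k).fib ((1 : G) : G ⧸ C))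
      map_one' := congrArg Multiplicative.ofAdd hone
      map_mul' := fun a b => by
        rw [← ofAdd_add, Subgroup.coe_mul, hmul]
        rw [show φ b = 1 from b.2]
        exact C.one_mem }
  have hτ : IsOpen (τ.ker : Set φ.ker) := by
    refine Subgroup.isOpen_mono (H₁ := γ.ker.subgroupOf φ.ker) (fun k hk => ?_)
      (hγ.preimage continuous_subtype_val)
    have hk' : γ k = 1 := hk
    change Multiplicative.ofAdd ((γ k).fib ((1 : G) : G ⧸ C)) = 1
    rw [hk', fib_one, ofAdd_zero]
  have hle := profiniteFrattini_le_ker hp τ hτ fun k => by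
    have := (γ k).cast_fib 1
    rw [hbase, show φ k = 1 from k.2] at this
    simpa [τ] using this
  rintro ⟨k, hk, hky⟩
  have hpow : ∀ n : ℕ, (γ (y ^ n)).fib ((1 : G) : G ⧸ C) =
      n * (γ y).fib ((1 : G) : G ⧸ C) := by
    intro n
    induction n with
    | zero => rw [pow_zero, hone, Nat.cast_zero, zero_mul]
    | succ n ih => rw [pow_succ y n, hmul _ _ hyC, ih]; push_cast; ring
  have hzero : (p : ZMod (p ^ 2)) * (γ y).fib ((1 : G) : G ⧸ C) = 0 := by
    rw [← hpow, ← hky]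
    exact congrArg Multiplicative.toAdd (hle hk)
  have hcast := ZMod.castHom_eq_zero_of_natCast_mul_eq_zero hzero
  -- The chosen representative of the trivial coset need not be `1`; only the difference of the
  -- values at `φ y` and `1` matters, and it is `e (φ y)`.
  have hext := transversalExt_mul e.toMonoidHom 1 ⟨_, hyC⟩
  rw [(γ y).cast_fib, hbase, mul_one, sub_eq_zero] at hcast
  rw [one_mul, hcast, left_eq_add] at hext
  have h1 : (⟨φ y, hyC⟩ : C) = 1 := e.injective (by rw [map_one]; exact hext)
  have h1' : φ y = 1 := congrArg Subtype.val h1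
  rw [h1', orderOf_one] at hy
  exact hp.one_lt.ne hy

theorem mainTheorem7 (p : ℕ) (hp : p.Prime) (G₀ : Type u) [Group G₀] [Finite G₀]
    (hdvd : p ∣ Nat.card G₀) (Γ : Type u) [Group Γ] [TopologicalSpace Γ] [IsTopologicalGroup Γ]
    [CompactSpace Γ] [T2Space Γ] [TotallyDisconnectedSpace Γ] (φ : Γ →* G₀)
    (hφ : IsUniversalPFrattiniCover p φ) (P₀ : Sylow p G₀) :
    ¬ RestrictionSplits (charQuotMap φ 1) (Subgroup.normalizer (P₀ : Set G₀)) := by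
  rintro ⟨s, hs⟩
  have := Fact.mk hp
  obtain ⟨x, hx⟩ := exists_prime_orderOf_dvd_card' (G := P₀) p (P₀.dvd_card_of_dvd_card hdvd)
  have hxN : (x : G₀) ∈ Subgroup.normalizer (P₀ : Set G₀) := Subgroup.le_normalizer x.2
  have hxp : (⟨x, hxN⟩ : Subgroup.normalizer (P₀ : Set G₀)) ^ p = 1 :=
    Subtype.ext (by simpa [hx] using congrArg Subtype.val (pow_orderOf_eq_one x))
  obtain ⟨y, hy⟩ := QuotientGroup.mk_surjective (s ⟨x, hxN⟩ : CharQuot φ 1)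
  have hφy : φ y = x := by
    have := congrArg Subtype.val (DFunLike.congr_fun hs ⟨x, hxN⟩)
    change charQuotMap φ 1 (s ⟨x, hxN⟩ : CharQuot φ 1) = x at this
    rw [← hy] at this
    exact this
  refine hφ.pow_notMem_frattiniIn_ker hp (y := y) (by rw [hφy, Subgroup.orderOf_coe, hx]) ?_
  change y ^ p ∈ charKer φ 1
  rw [← QuotientGroup.eq_one_iff, QuotientGroup.mk_pow, hy, ← Subgroup.coe_pow, ← map_pow, hxp]
  simp
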